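/- Let $K\ge 2$ and $T\ge 1$. In the $K$-armed adversarial bandit problem over $T$ rounds, a (randomised) strategy chooses in each round $t$, as a (measurable) function of the history $(I_s,\ell_{I_s,s})_{s<t}$ of its own past actions and the losses it observed, a probability vector $p_t$ over $\{1,\dots,K\}$, and samples its action $I_t$ from $p_t$. On a loss sequence $\ell_{1:T}\in[0,1]^{KT}$, fixed in advance, its regret is \[ R_T(\ell_{1:T})=\sum_{t=1}^T \ell_{I_t,t}-\min_{1\le i\le K}\sum_{t=1}^T \ell_{i,t}. \] Suppose a strategy and a constant $C>0$ are such that $\mathbb{E}[R_T(\ell_{1:T})]\le C\sqrt{(K-1)T}$ for every $\ell_{1:T}\in[0,1]^{KT}$. Let $\delta\in(0,1/4)$ satisfy \[ \sqrt{\frac{K-1}{T}}\,\log\frac{1}{4\delta}\le C \qquad\text{and}\qquad T\ge 32\log\frac{2}{\delta}. \] Then there exists $\ell_{1:T}\in[0,1]^{KT}$ for which \[ \mathbb{P}\left(R_T(\ell_{1:T})\ge \frac{\sqrt{(K-1)T}\,\log(1/(4\delta))}{203\,C}\right)\ge \frac{\delta}{2}. \] Expectation and probability are taken with respect to the randomness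 of the strategy. -/

import Mathlib

open MeasureTheory

namespace Bandit

/-- A loss sequence `ℓ_{1:T} ∈ [0,1]^{KT}`; `ℓ t i` is the loss of action `i` in round `t`. -/
abbrev Losses (K T : ℕ) : Type := Fin T → Fin K → unitInterval

/-- A (randomised) strategy for the `K`-armed bandit over `T` rounds. In round `t` (rounds are
numbered from `0`) it maps the list of the actions played and the losses observed in the `t`
earlier rounds, measurably, to a probability vector over the `K` actions. -/
structure Strategy (K T : ℕ) where
  weights : (t : Fin T) → (Fin t → Fin K × unitInterval) → Fin K → ℝ
  weights_mem : ∀ t h, weights t h ∈ stdSimplex ℝ (Fin K)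
  measurable_weights : ∀ t, Measurable (weights t)

/-- The history before round `t`: the earlier actions, each with the loss of that action only. -/
def history {K T : ℕ} (ℓ : Losses K T) (a : Fin T → Fin K) (t : Fin T) :
    Fin t → Fin K × unitInterval :=
  fun s => (a (s.castLE t.isLt.le), ℓ (s.castLE t.isLt.le) (a (s.castLE t.isLt.le)))

/-- The regret of the action sequence `a` on the loss sequence `ℓ`. -/
noncomputable def regret {K T : ℕ} (ℓ : Losses K T) (a : Fin T → Fin K) : ℝ :=
  ∑ t, (ℓ t (a t) : ℝ) - ⨅ i, ∑ t, (ℓ t i : ℝ)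

namespace Strategy

variable {K T : ℕ}

/-- The probability that the strategy plays the action sequence `a` on the loss sequence `ℓ`,
when the action of each round is sampled from the probability vector of that round. -/
def actionProb (π : Strategy K T) (ℓ : Losses K T) (a : Fin T → Fin K) : ℝ :=
  ∏ t, π.weights t (history ℓ a t) (a t)

/-- The law of the sequence of actions played by the strategy on the loss sequence `ℓ`. -/
noncomputable def actionLaw (π : Strategy K T) (ℓ : Losses K T) : Measure (Fin T → Fin K) :=
  ∑ a, ENNReal.ofReal (π.actionProb ℓ a) • Measure.dirac a

theorem actionProb_nonneg (π : Strategy K T) (ℓ : Losses K T) (a : Fin T → Fin K) :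
    0 ≤ π.actionProb ℓ a :=
  Finset.prod_nonneg fun t _ => (π.weights_mem t _).1 _

theorem sum_prod_eq_one {K : ℕ} : ∀ (T : ℕ) (q : (t : Fin T) → (Fin t → Fin K) → Fin K → ℝ),
    (∀ t h, ∑ i, q t h i = 1) →
    ∑ a : Fin T → Fin K, ∏ t, q t (fun s => a (s.castLE t.isLt.le)) (a t) = 1
  | 0, _, _ => by simp
  | T + 1, q, hq => by
    rw [← (Fin.snocEquiv fun _ : Fin (T + 1) => Fin K).sum_comp, Fintype.sum_prod_type_right]
    have ih := sum_prod_eq_one T (fun t => q t.castSucc) fun t h => hq _ _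
    rw [← ih]
    refine Finset.sum_congr rfl fun a _ => ?_
    have h1 : ∀ (t : Fin T) (x : Fin K) (s : Fin t.castSucc),
        (Fin.snoc a x : Fin (T + 1) → Fin K) (s.castLE t.castSucc.isLt.le)
          = a (Fin.castLE (n := t) t.isLt.le s) := fun t x s =>
      Fin.snoc_castSucc (α := fun _ => Fin K) x a (Fin.castLE (n := t) t.isLt.le s)
    have h2 : ∀ (x : Fin K) (s : Fin (Fin.last T)),
        (Fin.snoc a x : Fin (T + 1) → Fin K) (s.castLE (Fin.last T).isLt.le) = a s := fun x s =>
      Fin.snoc_castSucc (α := fun _ => Fin K) x a s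
    simp only [Fin.snocEquiv, Equiv.coe_fn_mk, Fin.prod_univ_castSucc, h1, h2, Fin.snoc_castSucc,
      Fin.snoc_last]
    rw [← Finset.mul_sum, hq, mul_one]
    rfl

instance (π : Strategy K T) (ℓ : Losses K T) : IsProbabilityMeasure (π.actionLaw ℓ) where
  measure_univ := by
    have h := sum_prod_eq_one T
      (fun t h => π.weights t fun s => (h s, ℓ (s.castLE t.isLt.le) (h s)))
      fun t h => (π.weights_mem t _).2
    have h' : ∑ a, π.actionProb ℓ a = 1 := h
    simp [actionLaw, ← ENNReal.ofReal_sum_of_nonneg fun a _ => π.actionProb_nonneg ℓ a, h']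

end Strategy

end Bandit

/-! A small expected regret forces little exploration, and an arm that is rarely tried can secretly
be the best one. Write u = √((K-1)/T) and L = log(1/(4δ)), and take a gap Δ of order uL/C. In the
first environment arm b is better by Δ than all the others. The regret bound limits the expected
plays of the other arms (`sum_mixProb_mul_pulls_le`), so some arm i is played at most of order
C/(Δu) times on average. Making i better than b by Δ gives a second environment. The relative
entropy between the observations is of order Δ² times that number of plays, and the constants bring
it below L. Bretagnolle–Huber (`half_exp_neg_le_sum_ite`) then gives total probability at least 2δ
to playing i in at least half of the rounds in the first environment, or in fewer in the second; one
of the two has probability at least δ, and either means that the best arm was missed in half of the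
rounds.

The losses must also be fixed in [0,1], and missing the best arm must cost regret on the realised
sequence, not just on average. For this all arms share one noise variable per round, and an arm's
quality only shifts it: the gap Δ survives in every round whose noise is not near the clipping
range's ends. The noise is two-sided geometric (`nonempty_noise`), so a shift changes the law of the
single observed loss by a factor at most exp(8Δ). A Chernoff bound (`sum_prod_ite_le_exp`) makes
many bad rounds unlikely, and averaging over the noise produces a deterministic loss sequence
(`exists_losses_of_le_sum_mixProb`). -/

namespace Bandit

/-! ### Finite probability: sequential means, relative entropy, testing, concentration. -/

/-- In a sequential process on a finite alphabet, a function of one symbol whose conditional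
mean given the past vanishes has mean zero. -/
theorem sum_prod_mul_eq_zero {Y : Type*} [Fintype Y] :
    ∀ (T : ℕ) (q : (t : Fin T) → (Fin t → Y) → Y → ℝ), (∀ t h, ∑ y, q t h y = 1) →
    ∀ (t : Fin T) (F : Y → ℝ), (∀ h, ∑ y, q t h y * F y = 0) →
    ∑ y : Fin T → Y, (∏ s, q s (fun r => y (r.castLE s.isLt.le)) (y s)) * F (y t) = 0
  | 0, _, _, t, _, _ => t.elim0
  | T + 1, q, hq, t, F, hF => by
    rw [← (Fin.snocEquiv fun _ : Fin (T + 1) => Y).sum_comp, Fintype.sum_prod_type_right]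
    have h1 : ∀ (a : Fin T → Y) (t : Fin T) (x : Y) (s : Fin t.castSucc),
        (Fin.snoc a x : Fin (T + 1) → Y) (s.castLE t.castSucc.isLt.le)
          = a (Fin.castLE (n := t) t.isLt.le s) := fun a t x s =>
      Fin.snoc_castSucc (α := fun _ => Y) x a (Fin.castLE (n := t) t.isLt.le s)
    have h2 : ∀ (a : Fin T → Y) (x : Y) (s : Fin (Fin.last T)),
        (Fin.snoc a x : Fin (T + 1) → Y) (s.castLE (Fin.last T).isLt.le) = a s := fun a x s =>
      Fin.snoc_castSucc (α := fun _ => Y) x a s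
    induction t using Fin.lastCases with
    | last =>
      refine Finset.sum_eq_zero fun a _ => ?_
      simp only [Fin.snocEquiv, Equiv.coe_fn_mk, Fin.prod_univ_castSucc, h1, h2,
        Fin.snoc_castSucc, Fin.snoc_last, mul_assoc]
      rw [← Finset.mul_sum, hF, mul_zero]
    | cast t =>
      have ih := sum_prod_mul_eq_zero T (fun t => q t.castSucc) (fun t h => hq _ _) t F hF
      rw [← ih]
      refine Finset.sum_congr rfl fun a _ => ?_
      simp only [Fin.snocEquiv, Equiv.coe_fn_mk, Fin.prod_univ_castSucc, h1, h2,
        Fin.snoc_castSucc, Fin.snoc_last]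
      rw [← Finset.sum_mul, ← Finset.mul_sum, hq, mul_one]
      rfl

/-- Two laws on a finite set whose likelihood ratio lies between `exp (-ε)` and `exp ε` have
relative entropy at most of order `ε ^ 2 / 2`. -/
theorem sum_mul_log_div_le {X : Type*} [Fintype X] {p q : X → ℝ} {ε : ℝ}
    (hp : ∀ x, 0 < p x) (hq : ∀ x, 0 < q x) (hp1 : ∑ x, p x = 1) (hq1 : ∑ x, q x = 1)
    (hε : ε ≤ 0.19) (hpq : ∀ x, p x ≤ Real.exp ε * q x) (hqp : ∀ x, q x ≤ Real.exp ε * p x) :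
    ∑ x, p x * Real.log (p x / q x) ≤ 0.545 * ε ^ 2 := by
  -- With q = p exp u this is a second-order bound on exp u - 1 - u; the first-order terms p - q
  -- cancel in the sum.
  have key : ∀ x, p x * Real.log (p x / q x) ≤ p x - q x + p x * (0.545 * ε ^ 2) := by
    intro x
    set u := Real.log (q x / p x) with hu
    have hqx : q x = p x * Real.exp u := by
      rw [hu, Real.exp_log (div_pos (hq x) (hp x)), mul_div_cancel₀ _ (hp x).ne']
    have hlog : Real.log (p x / q x) = -u := by
      rw [hu, ← Real.log_inv, inv_div]
    have h1 : u ≤ ε := by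
      rw [hu, Real.log_le_iff_le_exp (div_pos (hq x) (hp x)), div_le_iff₀ (hp x)]
      exact hqp x
    have h2 : -u ≤ ε := by
      rw [← hlog, Real.log_le_iff_le_exp (div_pos (hp x) (hq x)), div_le_iff₀ (hq x)]
      exact hpq x
    have habs : |u| ≤ ε := abs_le.2 ⟨by linarith, h1⟩
    -- The cubic remainder is at most (2/9)|u|³ ≤ (2/9)(0.19)ε², and 1/2 + 0.0423 < 0.545.
    have hb := Real.exp_bound (x := u) (by linarith) (n := 3) (by norm_num)
    norm_num [Finset.sum_range_succ, Nat.factorial] at hb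
    have hb' := (abs_le.1 hb).2
    have h3 : |u| ^ 3 ≤ 0.19 * ε ^ 2 := by
      have : |u| ^ 2 ≤ ε ^ 2 := pow_le_pow_left₀ (abs_nonneg u) habs 2
      nlinarith [abs_nonneg u, sq_nonneg ε]
    have h4 : u ^ 2 ≤ ε ^ 2 := by
      rw [← sq_abs]; exact pow_le_pow_left₀ (abs_nonneg u) habs 2
    have h5 : Real.exp u - 1 - u ≤ 0.545 * ε ^ 2 := by
      nlinarith [sq_nonneg ε]
    rw [hlog, hqx]
    nlinarith [mul_le_mul_of_nonneg_left h5 (hp x).le]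
  refine (Finset.sum_le_sum fun x _ => key x).trans ?_
  rw [Finset.sum_add_distrib, Finset.sum_sub_distrib, ← Finset.sum_mul, hp1, hq1]
  simp

/-- The Bretagnolle–Huber inequality for finite laws, the second one being given by its
log-likelihood ratio with respect to the first. -/
theorem half_exp_neg_le_sum_ite {Y : Type*} [Fintype Y] (Q D : Y → ℝ) (A : Y → Prop)
    [DecidablePred A] (hQ : ∀ y, 0 ≤ Q y) (hQ1 : ∑ y, Q y = 1)
    (hQ' : ∑ y, Q y * Real.exp (-D y) = 1) {L : ℝ} (hD : ∑ y, Q y * D y ≤ L) :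
    Real.exp (-L) / 2 ≤ ∑ y, Q y * (if A y then 1 else Real.exp (-D y)) := by
  set M := ∑ y, Q y * D y with hM
  -- Jensen's inequality, through the tangent line of the exponential at the mean.
  have h1 : Real.exp (-(M / 2)) ≤ ∑ y, Q y * Real.exp (-(D y / 2)) := by
    have : ∀ y, Q y * (Real.exp (-(M / 2)) * (M / 2 - D y / 2 + 1))
        ≤ Q y * Real.exp (-(D y / 2)) := fun y => by
      refine mul_le_mul_of_nonneg_left ?_ (hQ y)
      have h := mul_le_mul_of_nonneg_left (Real.add_one_le_exp (M / 2 - D y / 2))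
        (Real.exp_pos (-(M / 2))).le
      rw [← Real.exp_add] at h
      convert h using 2
      ring
    refine le_trans (le_of_eq ?_) (Finset.sum_le_sum fun y _ => this y)
    have h2 : ∀ y, Q y * (Real.exp (-(M / 2)) * (M / 2 - D y / 2 + 1))
        = Real.exp (-(M / 2)) * (M / 2 + 1) * Q y
          - Real.exp (-(M / 2)) / 2 * (Q y * D y) := fun y => by ring
    simp_rw [h2]
    rw [Finset.sum_sub_distrib, ← Finset.mul_sum, ← Finset.mul_sum, hQ1, ← hM]
    ring
  -- Cauchy–Schwarz, splitting the likelihood ratio as min(1, ·) times max(1, ·).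
  have h2 := Finset.sum_sq_le_sum_mul_sum_of_sq_le_mul Finset.univ
    (r := fun y => Q y * Real.exp (-(D y / 2)))
    (f := fun y => Q y * min 1 (Real.exp (-D y))) (g := fun y => Q y * max 1 (Real.exp (-D y)))
    (fun y _ => mul_nonneg (hQ y) (le_min zero_le_one (Real.exp_pos _).le))
    (fun y _ => mul_nonneg (hQ y) (zero_le_one.trans (le_max_left _ _)))
    (fun y _ => le_of_eq <| by
      have h : Real.exp (-(D y / 2)) ^ 2 = Real.exp (-D y) := by
        rw [← Real.exp_nat_mul]; congr 1; push_cast; ring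
      calc (Q y * Real.exp (-(D y / 2))) ^ 2
          = Q y ^ 2 * Real.exp (-D y) := by rw [mul_pow, h]
        _ = Q y ^ 2 * (min 1 (Real.exp (-D y)) * max 1 (Real.exp (-D y))) := by
          rw [min_mul_max, one_mul]
        _ = _ := by ring)
  have h3 : ∑ y, Q y * max 1 (Real.exp (-D y)) ≤ 2 := by
    have : ∀ y, Q y * max 1 (Real.exp (-D y)) ≤ Q y + Q y * Real.exp (-D y) := fun y => by
      rw [← mul_one_add]
      exact mul_le_mul_of_nonneg_left
        (max_le (by linarith [Real.exp_pos (-D y)]) (by linarith)) (hQ y)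
    refine (Finset.sum_le_sum fun y _ => this y).trans ?_
    rw [Finset.sum_add_distrib, hQ1, hQ']; norm_num
  have h4 : ∑ y, Q y * min 1 (Real.exp (-D y))
      ≤ ∑ y, Q y * (if A y then 1 else Real.exp (-D y)) :=
    Finset.sum_le_sum fun y _ => mul_le_mul_of_nonneg_left
      (by split_ifs; exacts [min_le_left _ _, min_le_right _ _]) (hQ y)
  have h5 : 0 ≤ ∑ y, Q y * min 1 (Real.exp (-D y)) :=
    Finset.sum_nonneg fun y _ => mul_nonneg (hQ y) (le_min zero_le_one (Real.exp_pos _).le)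
  have h6 : Real.exp (-M) ≤ (∑ y, Q y * Real.exp (-(D y / 2))) ^ 2 := by
    have h : Real.exp (-(M / 2)) ^ 2 = Real.exp (-M) := by
      rw [← Real.exp_nat_mul]; congr 1; push_cast; ring
    exact h ▸ pow_le_pow_left₀ (Real.exp_pos _).le h1 2
  have h7 : Real.exp (-L) ≤ Real.exp (-M) := Real.exp_le_exp.2 (by linarith)
  nlinarith

/-- A Chernoff bound for the number of rounds in which the noise falls into a set of
probability at most `1 / 6`. -/
theorem sum_prod_ite_le_exp {Z : Type*} [Fintype Z] (w : Z → ℝ) (hw : ∀ k, 0 ≤ w k)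
    (hw1 : ∑ k, w k = 1) (B : Z → Prop) [DecidablePred B]
    (hB : ∑ k, (if B k then w k else 0) ≤ 1 / 6) (T : ℕ) :
    ∑ z : Fin T → Z, (if 7 / 24 * (T : ℝ) ≤ ∑ t, (if B (z t) then (1 : ℝ) else 0)
      then ∏ t, w (z t) else 0) ≤ Real.exp (-(T / 32)) := by
  -- The Chernoff parameter is 1/2. One factor is at most 1 + 0.65/6 ≤ exp(11/96), and 11/96 -
  -- (1/2)(7/24) = -1/32.
  have hs : Real.exp (1 / 2) ≤ 1.65 := by
    have h := Real.exp_one_lt_d9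
    have h2 : Real.exp (1 / 2) ^ 2 = Real.exp 1 := by
      rw [← Real.exp_nat_mul]; norm_num
    nlinarith [Real.exp_pos (1 / 2)]
  have h1 : ∀ z : Fin T → Z, (if 7 / 24 * (T : ℝ) ≤ ∑ t, (if B (z t) then (1 : ℝ) else 0)
      then ∏ t, w (z t) else 0) ≤ Real.exp (-(7 / 48 * (T : ℝ))) *
        ∏ t, (w (z t) * Real.exp (1 / 2 * (if B (z t) then (1 : ℝ) else 0))) := by
    intro z
    have hW : 0 ≤ ∏ t, w (z t) := Finset.prod_nonneg fun t _ => hw _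
    rw [Finset.prod_mul_distrib, ← Real.exp_sum, ← Finset.mul_sum, mul_left_comm,
      ← Real.exp_add]
    split_ifs with h
    · exact le_mul_of_one_le_right hW (Real.one_le_exp (by linarith))
    · exact mul_nonneg hW (Real.exp_pos _).le
  refine (Finset.sum_le_sum fun z _ => h1 z).trans ?_
  have h2 : ∑ z : Fin T → Z, ∏ t, (w (z t) * Real.exp (1 / 2 * (if B (z t) then (1 : ℝ) else 0)))
      = (∑ k, w k * Real.exp (1 / 2 * (if B k then (1 : ℝ) else 0))) ^ T := by
    rw [← Fintype.prod_sum (fun (_ : Fin T) k =>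
      w k * Real.exp (1 / 2 * (if B k then (1 : ℝ) else 0)))]
    simp
  have h3 : ∑ k, w k * Real.exp (1 / 2 * (if B k then (1 : ℝ) else 0))
      ≤ Real.exp (11 / 96) := by
    have : ∀ k, w k * Real.exp (1 / 2 * (if B k then (1 : ℝ) else 0))
        = w k + (Real.exp (1 / 2) - 1) * (if B k then w k else 0) := fun k => by
      split_ifs
      · rw [mul_one]; ring
      · simp
    simp_rw [this]
    rw [Finset.sum_add_distrib, ← Finset.mul_sum, hw1]
    have h4 := Real.add_one_le_exp (11 / 96)
    have h5 : 0 ≤ ∑ k, (if B k then w k else 0) :=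
      Finset.sum_nonneg fun k _ => by split_ifs; exacts [hw k, le_rfl]
    nlinarith
  rw [← Finset.mul_sum, h2]
  have h6 : 0 ≤ ∑ k, w k * Real.exp (1 / 2 * (if B k then (1 : ℝ) else 0)) :=
    Finset.sum_nonneg fun k _ => mul_nonneg (hw k) (Real.exp_pos _).le
  refine (mul_le_mul_of_nonneg_left (pow_le_pow_left₀ h6 h3 T) (Real.exp_pos _).le).trans ?_
  rw [← Real.exp_nat_mul, ← Real.exp_add]
  exact Real.exp_le_exp.2 (by linarith)

/-! ### Shared noise built from clipped two-sided geometric weights. -/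

/-- Noise on a finite set together with three ways, `0`, `1` and `2`, to turn it into a loss. Away
from an event of small probability each way yields a loss smaller by `Δ` than the previous one,
whereas the laws of the losses are close to each other. -/
structure Noise (Δ : ℝ) where
  n : ℕ
  m : ℕ
  weight : Fin n → ℝ
  value : Fin m → unitInterval
  level : Fin 3 → Fin n → Fin m
  bad : Fin n → Prop
  [decidableBad : DecidablePred bad]
  weight_nonneg : ∀ k, 0 ≤ weight k
  sum_weight : ∑ k, weight k = 1
  sum_bad_le : ∑ k, (if bad k then weight k else 0) ≤ 1 / 6
  value_anti : ∀ k, Antitone fun s => (value (level s k) : ℝ)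
  gap_le : ∀ k, ¬ bad k → ∀ s s', s < s' →
    Δ ≤ (value (level s k) : ℝ) - value (level s' k)
  law_pos : ∀ s x, 0 < ∑ k, if level s k = x then weight k else 0
  law_le : ∀ s s' x, (∑ k, if level s k = x then weight k else 0) ≤
    Real.exp (8 * Δ) * ∑ k, if level s' k = x then weight k else 0

/-- Unnormalised two-sided geometric weights with centre `c` on `{0, …, 2 * c}`, the ends
carrying the mass of the tails. -/
noncomputable def geomWeight (r : ℝ) (c k : ℕ) : ℝ :=
  if k = 0 ∨ k = 2 * c then r ^ c else (1 - r) * r ^ ((k - c) + (c - k))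

section geomWeight

variable {r : ℝ} {c : ℕ}

theorem geomWeight_pos (h0 : 0 < r) (h1 : r < 1) (k : ℕ) : 0 < geomWeight r c k := by
  have : 0 < 1 - r := by linarith
  rw [geomWeight]; split_ifs <;> positivity

theorem geomWeight_zero : geomWeight r c 0 = r ^ c := by simp [geomWeight]

theorem geomWeight_two_mul : geomWeight r c (2 * c) = r ^ c := by simp [geomWeight]

theorem geomWeight_left {i j : ℕ} (h : i + j = c) (hj : j ≠ 0) :
    geomWeight r c j = (1 - r) * r ^ i := by
  rw [geomWeight, if_neg (by omega)]
  congr 2; omega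

theorem geomWeight_right {i : ℕ} (h : i < c) : geomWeight r c (c + i) = (1 - r) * r ^ i := by
  rw [geomWeight, if_neg (by omega)]
  congr 2; omega

theorem sum_geomWeight_left : ∀ {i j : ℕ}, i + j = c → i ≠ 0 →
    ∑ k ∈ Finset.range (j + 1), geomWeight r c k = r ^ i
  | i, 0, h, _ => by simp [geomWeight_zero, ← h]
  | i, j + 1, h, hi => by
    rw [Finset.sum_range_succ, sum_geomWeight_left (i := i + 1) (by omega) (by omega),
      geomWeight_left h (by omega)]
    ring

theorem sum_geomWeight_right : ∀ {j : ℕ}, j ≤ c →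
    ∑ k ∈ Finset.range j, geomWeight r c (c + k) = 1 - r ^ j
  | 0, _ => by simp
  | j + 1, h => by
    rw [Finset.sum_range_succ, sum_geomWeight_right (by omega), geomWeight_right (by omega)]
    ring

theorem sum_geomWeight (hc : c ≠ 0) :
    ∑ k ∈ Finset.range (2 * c + 1), geomWeight r c k = 1 + r := by
  obtain ⟨m, rfl⟩ := Nat.exists_eq_succ_of_ne_zero hc
  rw [Finset.sum_range_succ, geomWeight_two_mul, two_mul, Finset.sum_range_add,
    sum_geomWeight_right le_rfl, sum_geomWeight_left (i := 1) (j := m) (by omega) one_ne_zero]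
  ring

theorem geomWeight_le {k k' : ℕ} (h0 : 0 < r) (h1 : r < 1) (hk : k ≠ 0) (hk2 : k < 2 * c)
    (hk' : k' ≠ 0) (hk2' : k' < 2 * c) (h : k ≤ k' + 2) (h' : k' ≤ k + 2) :
    r ^ 2 * geomWeight r c k ≤ geomWeight r c k' := by
  rw [geomWeight, if_neg (by omega), geomWeight, if_neg (by omega), mul_left_comm, ← pow_add]
  exact mul_le_mul_of_nonneg_left (pow_le_pow_of_le_one h0.le h1.le (by omega)) (by linarith)

/-- The mass that the geometric weights give to the level `x` when the noise is lowered by `s` and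
clipped. -/
noncomputable def levelMass (r : ℝ) (m s x : ℕ) : ℝ :=
  ∑ k ∈ Finset.range (2 * m + 3), if min (k - s) (2 * m) = x then geomWeight r (m + 1) k else 0

theorem levelMass_inner {m s x : ℕ} (hs : s ≤ 2) (hx : x ≠ 0) (hxm : x < 2 * m) :
    levelMass r m s x = geomWeight r (m + 1) (x + s) := by
  rw [levelMass, Finset.sum_eq_single (x + s)]
  · rw [if_pos (by omega)]
  · intro k _ hk
    rw [if_neg (by omega)]
  · intro h
    exact absurd (Finset.mem_range.2 (by omega)) h

theorem levelMass_bottom {m s i : ℕ} (hs : s ≤ 2) (hm : 2 ≤ m) (hi : i + s = m + 1) :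
    levelMass r m s 0 = r ^ i := by
  rw [levelMass, ← Finset.sum_filter, ← sum_geomWeight_left (c := m + 1) hi (by omega)]
  refine Finset.sum_congr ?_ fun _ _ => rfl
  ext k
  simp only [Finset.mem_filter, Finset.mem_range]
  omega

theorem levelMass_top {m s i : ℕ} (hs : s ≤ 2) (hm : 2 ≤ m) (hi : i + 1 = m + s) :
    levelMass r m s (2 * m) = r ^ i := by
  have hsplit : ∑ k ∈ Finset.range (2 * m + 3), geomWeight r (m + 1) k
      = ∑ k ∈ Finset.range (m + 1 + i), geomWeight r (m + 1) k + levelMass r m s (2 * m) := by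
    rw [levelMass, ← Finset.sum_filter, ← Finset.sum_filter_add_sum_filter_not
      (Finset.range (2 * m + 3)) (fun k => min (k - s) (2 * m) = 2 * m), add_comm]
    congr 1
    refine Finset.sum_congr ?_ fun _ _ => rfl
    ext k
    simp only [Finset.mem_filter, Finset.mem_range]
    omega
  have h := sum_geomWeight (r := r) (c := m + 1) (by omega)
  rw [show 2 * (m + 1) + 1 = 2 * m + 3 by ring, hsplit, Finset.sum_range_add,
    sum_geomWeight_right (by omega),
    sum_geomWeight_left (i := 1) (j := m) (by omega) one_ne_zero] at h
  linarith

/-- Clipping does no harm: tails of a geometric law are themselves powers of r, so a shift by at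
most 2 moves the exponent by at most 2 at the end levels as well as inside. -/
theorem sq_mul_levelMass_le {m s s' x : ℕ} (h0 : 0 < r) (h1 : r < 1) (hm : 2 ≤ m) (hs : s ≤ 2)
    (hs' : s' ≤ 2) (hx : x ≤ 2 * m) : r ^ 2 * levelMass r m s x ≤ levelMass r m s' x := by
  rcases eq_or_ne x 0 with rfl | hx0
  · obtain ⟨i, hi⟩ : ∃ i, i + s = m + 1 := ⟨m + 1 - s, by omega⟩
    obtain ⟨i', hi'⟩ : ∃ i, i + s' = m + 1 := ⟨m + 1 - s', by omega⟩
    rw [levelMass_bottom hs hm hi, levelMass_bottom hs' hm hi', ← pow_add]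
    exact pow_le_pow_of_le_one h0.le h1.le (by omega)
  rcases hx.eq_or_lt with rfl | hx
  · obtain ⟨i, hi⟩ : ∃ i, i + 1 = m + s := ⟨m + s - 1, by omega⟩
    obtain ⟨i', hi'⟩ : ∃ i, i + 1 = m + s' := ⟨m + s' - 1, by omega⟩
    rw [levelMass_top hs hm hi, levelMass_top hs' hm hi', ← pow_add]
    exact pow_le_pow_of_le_one h0.le h1.le (by omega)
  · rw [levelMass_inner hs hx0 hx, levelMass_inner hs' hx0 hx]
    exact geomWeight_le h0 h1 (by omega) (by omega) (by omega) (by omega) (by omega) (by omega)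

theorem levelMass_pos {m s x : ℕ} (h0 : 0 < r) (h1 : r < 1) (hs : s ≤ 2) (hx : x ≤ 2 * m) :
    0 < levelMass r m s x := by
  refine Finset.sum_pos' (fun k _ => ?_) ⟨x + s, Finset.mem_range.2 (by omega), ?_⟩
  · split_ifs
    exacts [(geomWeight_pos h0 h1 k).le, le_rfl]
  · rw [if_pos (by omega)]
    exact geomWeight_pos h0 h1 _

theorem sum_geomWeight_ends {m : ℕ} (hm : 2 ≤ m) :
    ∑ k ∈ Finset.range (2 * m + 3), (if k < 2 ∨ 2 * m < k then geomWeight r (m + 1) k else 0)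
      = 2 * r ^ m := by
  have h : ∀ k ∈ Finset.range (2 * m + 3),
      -- The end indices are exactly those that way `1` sends to an extreme level, so their mass is
      -- already known.
      (if k < 2 ∨ 2 * m < k then geomWeight r (m + 1) k else 0)
      = (if min (k - 1) (2 * m) = 0 then geomWeight r (m + 1) k else 0)
        + (if min (k - 1) (2 * m) = 2 * m then geomWeight r (m + 1) k else 0) := by
    intro k _
    split_ifs <;> first | omega | simp
  rw [Finset.sum_congr rfl h, Finset.sum_add_distrib]
  have h1 := levelMass_bottom (r := r) (m := m) (s := 1) (i := m) (by omega) hm rfl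
  have h2 := levelMass_top (r := r) (m := m) (s := 1) (i := m) (by omega) hm rfl
  rw [levelMass] at h1 h2
  rw [h1, h2]; ring

end geomWeight

/-- The range is as wide as Δ · 2m ≤ 1 allows. The decay r = exp(-4Δ) makes r² = exp(-8Δ) the price
of a shift by 2, and is still fast enough to leave mass at most 1/6 near the ends. -/
theorem nonempty_noise {Δ : ℝ} (hΔ : 0 < Δ) (hΔ' : 8 * Δ ≤ 0.19) : Nonempty (Noise Δ) := by
  set r := Real.exp (-(4 * Δ)) with hr
  have h0 : 0 < r := Real.exp_pos _
  have h1 : r < 1 :=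
    (Real.exp_lt_exp.2 (by linarith : -(4 * Δ) < 0)).trans_eq Real.exp_zero
  set m := ⌊1 / (2 * Δ)⌋₊ with hm
  have hmle : (m : ℝ) ≤ 1 / (2 * Δ) := Nat.floor_le (by positivity)
  have hmlt : 1 / (2 * Δ) < m + 1 := Nat.lt_floor_add_one _
  rw [le_div_iff₀ (by positivity)] at hmle
  rw [div_lt_iff₀ (by positivity)] at hmlt
  have hm2 : 2 ≤ m := by
    have : (1 : ℝ) < m := by nlinarith
    exact_mod_cast this
  have hlevel : ∀ s k : ℕ, min (k - s) (2 * m) < 2 * m + 1 := fun s k => by omega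
  have hval : ∀ x : Fin (2 * m + 1), Δ * (x : ℕ) ∈ Set.Icc (0 : ℝ) 1 := fun x => by
    have hx : ((x : ℕ) : ℝ) ≤ 2 * m := by exact_mod_cast Nat.lt_succ_iff.1 x.isLt
    exact ⟨by positivity, by nlinarith⟩
  have hlaw : ∀ (s : Fin 3) (x : Fin (2 * m + 1)),
      (∑ k : Fin (2 * m + 3), if (⟨min (k - s) (2 * m), hlevel s k⟩ : Fin (2 * m + 1)) = x
        then geomWeight r (m + 1) k / (1 + r) else 0) = levelMass r m s x / (1 + r) := by
    intro s x
    rw [levelMass, Finset.sum_div, ← Fin.sum_univ_eq_sum_range (fun k =>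
      (if min (k - s) (2 * m) = x then geomWeight r (m + 1) k else 0) / (1 + r))]
    refine Finset.sum_congr rfl fun k _ => ?_
    simp only [Fin.ext_iff]
    split_ifs <;> simp
  refine ⟨{
    n := 2 * m + 3
    m := 2 * m + 1
    weight := fun k => geomWeight r (m + 1) k / (1 + r)
    value := fun x => ⟨Δ * (x : ℕ), hval x⟩
    level := fun s k => ⟨min (k - s) (2 * m), hlevel s k⟩
    bad := fun k => (k : ℕ) < 2 ∨ 2 * m < k
    weight_nonneg := fun k => div_nonneg (geomWeight_pos h0 h1 _).le (by linarith)
    sum_weight := ?_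
    sum_bad_le := ?_
    value_anti := ?_
    gap_le := ?_
    law_pos := fun s x => ?_
    law_le := fun s s' x => ?_ }⟩
  · rw [← Finset.sum_div, Fin.sum_univ_eq_sum_range (geomWeight r (m + 1)),
      show 2 * m + 3 = 2 * (m + 1) + 1 by ring, sum_geomWeight (by omega), div_self (by linarith)]
  · have h := sum_geomWeight_ends (r := r) hm2
    rw [← Fin.sum_univ_eq_sum_range (fun k =>
      if k < 2 ∨ 2 * m < k then geomWeight r (m + 1) k else 0)] at h
    have h' : ∑ k : Fin (2 * m + 3), (if (k : ℕ) < 2 ∨ 2 * m < k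
        then geomWeight r (m + 1) k / (1 + r) else 0) = 2 * r ^ m / (1 + r) := by
      rw [← h, Finset.sum_div]
      refine Finset.sum_congr rfl fun k _ => ?_
      split_ifs <;> simp
    rw [h', div_le_iff₀ (by linarith)]
    obtain ⟨j, hj⟩ : ∃ j, m = j + 1 := ⟨m - 1, by omega⟩
    -- From 2Δ(m + 1) > 1 the exponent 4Δ(m - 1) exceeds 2 - 0.19 > 1.8. The factor r held back
    -- absorbs the normalisation, since 2r ≤ 1 + r.
    have hrj : r ^ j ≤ 1 / 6 := by
      have h6 : (6 : ℝ) ≤ Real.exp 1.8 := by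
        have e1 := Real.exp_one_gt_d9
        have e3 : Real.exp 1.8 = Real.exp 1 * Real.exp 0.8 := by
          rw [← Real.exp_add]; norm_num
        have e2 := Real.sum_le_exp_of_nonneg (x := 0.8) (by norm_num) 5
        norm_num [Finset.sum_range_succ, Nat.factorial] at e2
        rw [e3]
        nlinarith [Real.exp_pos 0.8]
      have h7 : r ^ j = Real.exp (-((j : ℝ) * (4 * Δ))) := by
        rw [hr, ← Real.exp_nat_mul]; congr 1; ring
      have hjm : (m : ℝ) = j + 1 := by exact_mod_cast hj
      have h8 : r ^ j ≤ Real.exp (-1.8) := by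
        rw [h7]
        exact Real.exp_le_exp.2 (by rw [hjm] at hmlt; nlinarith)
      rw [Real.exp_neg] at h8
      refine h8.trans ?_
      rw [one_div]
      exact inv_anti₀ (by norm_num) h6
    rw [hj, pow_succ]
    nlinarith [pow_pos h0 j]
  · intro k s s' h
    have hle : (s : ℕ) ≤ s' := h
    refine mul_le_mul_of_nonneg_left ?_ hΔ.le
    exact_mod_cast (by omega : min ((k : ℕ) - s') (2 * m) ≤ min ((k : ℕ) - s) (2 * m))
  · intro k hk s s' h
    have hlt : (s : ℕ) < s' := h
    have hs' := s'.isLt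
    have hn : min ((k : ℕ) - s') (2 * m) + 1 ≤ min ((k : ℕ) - s) (2 * m) := by omega
    have hn' : ((min ((k : ℕ) - s') (2 * m) : ℕ) : ℝ) + 1 ≤ (min ((k : ℕ) - s) (2 * m) : ℕ) := by
      exact_mod_cast hn
    change Δ ≤ Δ * ((min ((k : ℕ) - s) (2 * m) : ℕ) : ℝ)
      - Δ * ((min ((k : ℕ) - s') (2 * m) : ℕ) : ℝ)
    nlinarith
  · rw [hlaw]
    exact div_pos (levelMass_pos h0 h1 (by omega) (by omega)) (by linarith)
  · rw [hlaw, hlaw, ← mul_div_assoc]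
    refine div_le_div_of_nonneg_right ?_ (by linarith)
    have h := sq_mul_levelMass_le (s := s) (s' := s') (x := x) h0 h1 hm2 (by omega) (by omega)
      (by omega)
    have hexp : Real.exp (8 * Δ) * r ^ 2 = 1 := by
      rw [hr, ← Real.exp_nat_mul, ← Real.exp_add, Real.exp_eq_one_iff]; push_cast; ring
    calc levelMass r m s x = Real.exp (8 * Δ) * (r ^ 2 * levelMass r m s x) := by
          rw [← mul_assoc, hexp, one_mul]
      _ ≤ _ := mul_le_mul_of_nonneg_left h (Real.exp_pos _).le

/-! ### Pushing independent noise forward, and conditional means. -/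

theorem sum_prod_weight_mul_comp {ι Z X : Type*} [Fintype ι] [DecidableEq ι] [Fintype Z]
    [Fintype X] [DecidableEq X] (w : Z → ℝ) (f : ι → Z → X) (G : (ι → X) → ℝ) :
    ∑ z : ι → Z, (∏ t, w (z t)) * G (fun t => f t (z t))
      = ∑ x : ι → X, (∏ t, ∑ k, if f t k = x t then w k else 0) * G x := by
  have h : ∀ x : ι → X, (∏ t, ∑ k, if f t k = x t then w k else 0)
      = ∑ z : ι → Z, if (fun t => f t (z t)) = x then ∏ t, w (z t) else 0 := by
    intro x
    rw [Fintype.prod_sum]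
    refine Finset.sum_congr rfl fun z _ => ?_
    rw [Finset.prod_ite_zero]
    simp [funext_iff]
  simp_rw [h, Finset.sum_mul]
  rw [Finset.sum_comm]
  refine Finset.sum_congr rfl fun z _ => ?_
  simp [ite_mul]

/-- If each symbol is a pair whose second entry is drawn, given the first one, independently of
the past, then a function of one symbol may be replaced by its mean given the first entry. -/
theorem sum_prod_mul_eq_sum_prod_mul_mean {I X : Type*} [Fintype I] [Fintype X] {T : ℕ}
    (α : (t : Fin T) → (Fin t → I × X) → I → ℝ) (ω : I → X → ℝ) (hα : ∀ t h, ∑ i, α t h i = 1)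
    (hω : ∀ i, ∑ x, ω i x = 1) (t : Fin T) (F : I → X → ℝ) :
    ∑ y : Fin T → I × X,
        (∏ s, (α s (fun r => y (r.castLE s.isLt.le)) (y s).1 * ω (y s).1 (y s).2))
          * F (y t).1 (y t).2
      = ∑ y : Fin T → I × X,
        (∏ s, (α s (fun r => y (r.castLE s.isLt.le)) (y s).1 * ω (y s).1 (y s).2))
          * ∑ x, ω (y t).1 x * F (y t).1 x := by
  rw [← sub_eq_zero, ← Finset.sum_sub_distrib]
  simp_rw [← mul_sub]
  refine sum_prod_mul_eq_zero T (fun t h y => α t h y.1 * ω y.1 y.2) ?_ t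
    (fun y => F y.1 y.2 - ∑ x, ω y.1 x * F y.1 x) ?_
  · intro t h
    simp_rw [Fintype.sum_prod_type, ← Finset.mul_sum, hω, mul_one, hα]
  · intro h
    rw [Fintype.sum_prod_type]
    refine Finset.sum_eq_zero fun i _ => ?_
    simp_rw [mul_assoc, ← Finset.mul_sum, mul_sub, Finset.sum_sub_distrib, ← Finset.sum_mul,
      hω, one_mul, sub_self, mul_zero]

/-! ### Probabilities and expectations under the action law as finite sums. -/

namespace Strategy

variable {K T : ℕ} (π : Strategy K T) (ℓ : Losses K T)

theorem sum_actionProb : ∑ a, π.actionProb ℓ a = 1 :=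
  sum_prod_eq_one T (fun t h => π.weights t fun s => (h s, ℓ (s.castLE t.isLt.le) (h s)))
    fun t _ => (π.weights_mem t _).2

theorem actionLaw_real_eq (S : Set (Fin T → Fin K)) [DecidablePred (· ∈ S)] :
    (π.actionLaw ℓ).real S = ∑ a, if a ∈ S then π.actionProb ℓ a else 0 := by
  rw [Measure.real, actionLaw, Measure.finsetSum_apply,
    ENNReal.toReal_sum fun a _ => by
      rw [Measure.smul_apply, smul_eq_mul]
      exact ENNReal.mul_ne_top ENNReal.ofReal_ne_top (measure_ne_top _ _)]
  refine Finset.sum_congr rfl fun a _ => ?_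
  simp only [Measure.smul_apply, Measure.dirac_apply, smul_eq_mul, ENNReal.toReal_mul,
    ENNReal.toReal_ofReal (π.actionProb_nonneg ℓ a), Set.indicator_apply, Pi.one_apply]
  split_ifs <;> simp

theorem integral_actionLaw (f : (Fin T → Fin K) → ℝ) :
    ∫ a, f a ∂(π.actionLaw ℓ) = ∑ a, π.actionProb ℓ a * f a := by
  classical
  rw [integral_fintype (Integrable.of_finite)]
  refine Finset.sum_congr rfl fun a _ => ?_
  rw [actionLaw_real_eq]
  simp

end Strategy

theorem sum_sub_le_regret {K T : ℕ} (ℓ : Losses K T) (a : Fin T → Fin K) (i : Fin K) :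
    ∑ t, ((ℓ t (a t) : ℝ) - ℓ t i) ≤ regret ℓ a := by
  rw [regret, Finset.sum_sub_distrib]
  exact sub_le_sub_left
    (ciInf_le (f := fun j => ∑ t, (ℓ t j : ℝ)) (Set.finite_range _).bddBelow i) _

/-! ### Random environments: observations, information and regret. -/

namespace Noise

variable {Δ : ℝ} (N : Noise Δ) {K T : ℕ}

instance : DecidablePred N.bad := N.decidableBad

/-- The losses produced by the noise sequence `z` when arm `i` uses the way `σ i`. -/
def losses (σ : Fin K → Fin 3) (z : Fin T → Fin N.n) : Losses K T :=
  fun t i => N.value (N.level (σ i) (z t))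

/-- The law of the loss level obtained in the way `s`. -/
def law (s : Fin 3) (x : Fin N.m) : ℝ := ∑ k, if N.level s k = x then N.weight k else 0

theorem sum_law (s : Fin 3) : ∑ x, N.law s x = 1 := by
  simp_rw [law]
  rw [Finset.sum_comm, ← N.sum_weight]
  exact Finset.sum_congr rfl fun k _ => by simp

/-- The probability of a noise sequence with independent entries. -/
def prob (z : Fin T → Fin N.n) : ℝ := ∏ t, N.weight (z t)

theorem prob_nonneg (z : Fin T → Fin N.n) : 0 ≤ N.prob z :=
  Finset.prod_nonneg fun _ _ => N.weight_nonneg _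

theorem sum_prob : ∑ z : Fin T → Fin N.n, N.prob z = 1 := by
  simp_rw [prob]
  rw [← Fintype.prod_sum (fun (_ : Fin T) k => N.weight k)]
  simp [N.sum_weight]

/-- The number of rounds with bad noise. -/
def badCount (z : Fin T → Fin N.n) : ℝ := ∑ t, if N.bad (z t) then 1 else 0

variable (π : Strategy K T) (σ : Fin K → Fin 3)

/-- The probability of an action sequence when the losses are produced by random noise. -/
def mixProb (a : Fin T → Fin K) : ℝ := ∑ z, N.prob z * π.actionProb (N.losses σ z) a

/-- The probability of a sequence of actions and observed loss levels when the losses are produced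
by random noise. -/
def obsProb (y : Fin T → Fin K × Fin N.m) : ℝ :=
  ∏ t, (π.weights t (fun s => ((y (s.castLE t.isLt.le)).1, N.value (y (s.castLE t.isLt.le)).2))
    (y t).1 * N.law (σ (y t).1) (y t).2)

theorem sum_mixProb_mul_eq (f : (Fin T → Fin K) → ℝ) :
    ∑ a, N.mixProb π σ a * f a = ∑ z, N.prob z * ∑ a, π.actionProb (N.losses σ z) a * f a := by
  simp_rw [mixProb, Finset.sum_mul, Finset.mul_sum]
  rw [Finset.sum_comm]
  simp_rw [mul_assoc]

/-- Bandit feedback enters here: for a fixed action sequence the strategy's weights depend on the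
noise only through the levels of the played arms, which are independent across rounds. -/
theorem mixProb_eq_sum_obsProb (a : Fin T → Fin K) :
    N.mixProb π σ a = ∑ x : Fin T → Fin N.m, N.obsProb π σ fun t => (a t, x t) := by
  have h := sum_prod_weight_mul_comp N.weight (fun t => N.level (σ (a t)))
    (fun x => ∏ t, π.weights t
      (fun s => (a (s.castLE t.isLt.le), N.value (x (s.castLE t.isLt.le)))) (a t))
  refine h.trans (Finset.sum_congr rfl fun x _ => ?_)
  rw [obsProb, Finset.prod_mul_distrib, mul_comm]
  rfl

theorem sum_mixProb_mul (f : (Fin T → Fin K) → ℝ) :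
    ∑ a, N.mixProb π σ a * f a = ∑ y, N.obsProb π σ y * f fun t => (y t).1 := by
  rw [← (Equiv.arrowProdEquivProdArrow (Fin T) (fun _ => Fin K) (fun _ => Fin N.m)).symm.sum_comp,
    Fintype.sum_prod_type]
  refine Finset.sum_congr rfl fun a _ => ?_
  rw [mixProb_eq_sum_obsProb, Finset.sum_mul]
  rfl

theorem obsProb_nonneg (y : Fin T → Fin K × Fin N.m) : 0 ≤ N.obsProb π σ y :=
  Finset.prod_nonneg fun t _ => mul_nonneg ((π.weights_mem t _).1 _) (N.law_pos _ _).le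

theorem mixProb_nonneg (a : Fin T → Fin K) : 0 ≤ N.mixProb π σ a :=
  Finset.sum_nonneg fun z _ => mul_nonneg (N.prob_nonneg z) (π.actionProb_nonneg _ _)

theorem sum_obsProb : ∑ y, N.obsProb π σ y = 1 := by
  have h := N.sum_mixProb_mul π σ fun _ => 1
  have h' := N.sum_mixProb_mul_eq π σ fun _ => 1
  simp only [mul_one, Strategy.sum_actionProb, sum_prob] at h h'
  rw [← h, h']

/-- The log-likelihood ratio of the observations between two environments. -/
noncomputable def logRatio (σ σ' : Fin K → Fin 3) (y : Fin T → Fin K × Fin N.m) : ℝ :=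
  ∑ t, Real.log (N.law (σ (y t).1) (y t).2 / N.law (σ' (y t).1) (y t).2)

theorem obsProb_mul_exp_neg_logRatio (σ' : Fin K → Fin 3) (y : Fin T → Fin K × Fin N.m) :
    N.obsProb π σ y * Real.exp (-N.logRatio σ σ' y) = N.obsProb π σ' y := by
  rw [logRatio, ← Finset.sum_neg_distrib, Real.exp_sum, obsProb, obsProb,
    ← Finset.prod_mul_distrib]
  refine Finset.prod_congr rfl fun t _ => ?_
  have h1 : 0 < N.law (σ (y t).1) (y t).2 := N.law_pos _ _
  have h2 : 0 < N.law (σ' (y t).1) (y t).2 := N.law_pos _ _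
  rw [← Real.log_inv, inv_div, Real.exp_log (div_pos h2 h1), mul_assoc,
    mul_div_cancel₀ _ h1.ne']

/-- The number of rounds in which arm `i` is played. -/
def pulls (i : Fin K) (a : Fin T → Fin K) : ℝ := ∑ t, if a t = i then 1 else 0

/-- Chain rule for relative entropy: given the past and the action, a round contributes the
divergence between two loss laws, which vanishes unless arm `i` is played. -/
theorem sum_obsProb_mul_logRatio_le (hΔ : 8 * Δ ≤ 0.19) (σ' : Fin K → Fin 3) (i : Fin K)
    (hσ : ∀ a, a ≠ i → σ' a = σ a) :
    ∑ y, N.obsProb π σ y * N.logRatio σ σ' y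
      ≤ 0.545 * (8 * Δ) ^ 2 * ∑ a, N.mixProb π σ a * pulls i a := by
  rw [sum_mixProb_mul]
  simp_rw [logRatio, pulls, Finset.mul_sum]
  rw [Finset.sum_comm, Finset.sum_comm (s := Finset.univ (α := Fin T → Fin K × Fin N.m))]
  refine Finset.sum_le_sum fun t _ => ?_
  have h := sum_prod_mul_eq_sum_prod_mul_mean
    (fun (t : Fin T) (h : Fin t → Fin K × Fin N.m) => π.weights t
      (fun s => ((h s).1, N.value (h s).2))) (fun a => N.law (σ a))
    (fun t h => (π.weights_mem t _).2) (fun a => N.sum_law _) t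
    (fun a x => Real.log (N.law (σ a) x / N.law (σ' a) x))
  refine (le_of_eq h).trans (Finset.sum_le_sum fun y _ => ?_)
  rw [mul_left_comm]
  refine mul_le_mul_of_nonneg_left ?_ (N.obsProb_nonneg π σ y)
  split_ifs with hi
  · rw [mul_one]
    exact sum_mul_log_div_le (N.law_pos _) (N.law_pos _) (N.sum_law _) (N.sum_law _) hΔ
      (N.law_le _ _) (N.law_le _ _)
  · rw [hσ _ hi, mul_zero]
    refine (Finset.sum_eq_zero fun x _ => ?_).le
    have : N.law (σ (y t).1) x ≠ 0 := (N.law_pos _ _).ne'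
    rw [div_self this, Real.log_one, mul_zero]

/-- If the average regret is at most `R`, the environment in which arm `b` uses the way `1` and
all others the way `0` bounds the expected number of plays of the other arms. -/
theorem sum_mixProb_mul_pulls_le (hΔ : 0 < Δ) {R : ℝ}
    (hπ : ∀ ℓ : Losses K T, ∫ a, regret ℓ a ∂(π.actionLaw ℓ) ≤ R) (b : Fin K)
    (hb : σ b = 1) (hσ : ∀ a, a ≠ b → σ a = 0) :
    Δ * (5 / 6) * ∑ i ∈ Finset.univ.erase b, ∑ a, N.mixProb π σ a * pulls i a ≤ R := by
  set g : Fin K → Fin N.n → ℝ := fun a k =>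
    (N.value (N.level (σ a) k) : ℝ) - N.value (N.level (σ b) k) with hg
  -- Bad noise never reverses the order of the arms, and good noise, of probability at least 5/6,
  -- costs Δ.
  have hmean : ∀ a, Δ * (5 / 6) * (∑ i ∈ Finset.univ.erase b, if a = i then 1 else 0)
      ≤ ∑ k, N.weight k * g a k := by
    intro a
    rw [Finset.sum_ite_eq]
    by_cases hab : a = b
    · simp [hg, hab]
    · rw [if_pos (by simp [hab]), mul_one]
      have : ∀ k, Δ * N.weight k - Δ * (if N.bad k then N.weight k else 0)
          ≤ N.weight k * g a k := by
        intro k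
        have hw := N.weight_nonneg k
        simp only [hg, hb, hσ a hab]
        split_ifs with hk
        · rw [sub_self]
          exact mul_nonneg hw (sub_nonneg.2 (N.value_anti k (by decide : (0 : Fin 3) ≤ 1)))
        · have := N.gap_le k hk 0 1 (by decide)
          nlinarith
      refine le_trans ?_ (Finset.sum_le_sum fun k _ => this k)
      rw [Finset.sum_sub_distrib, ← Finset.mul_sum, ← Finset.mul_sum, N.sum_weight]
      nlinarith [N.sum_bad_le]
  -- Actions and noise form a sequential process in which each round's noise is independent of its
  -- action, so `g` may be replaced by its mean over the noise.
  have hjoint : ∀ f : Fin K → Fin N.n → ℝ, ∀ t : Fin T,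
      ∑ z, N.prob z * ∑ a, π.actionProb (N.losses σ z) a * f (a t) (z t)
      = ∑ y : Fin T → Fin K × Fin N.n, (∏ s, (π.weights s
        (fun r => ((y (r.castLE s.isLt.le)).1,
          N.value (N.level (σ (y (r.castLE s.isLt.le)).1) (y (r.castLE s.isLt.le)).2))) (y s).1
            * N.weight (y s).2)) * f (y t).1 (y t).2 := by
    intro f t
    rw [← (Equiv.arrowProdEquivProdArrow (Fin T) (fun _ => Fin K)
      (fun _ => Fin N.n)).symm.sum_comp, Fintype.sum_prod_type_right]
    refine Finset.sum_congr rfl fun z _ => ?_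
    rw [Finset.mul_sum]
    refine Finset.sum_congr rfl fun a _ => ?_
    rw [Finset.prod_mul_distrib, ← mul_assoc, mul_comm (N.prob z)]
    rfl
  have hswap : ∀ t : Fin T,
      ∑ z, N.prob z * ∑ a, π.actionProb (N.losses σ z) a * g (a t) (z t)
      = ∑ a, N.mixProb π σ a * ∑ k, N.weight k * g (a t) k := by
    intro t
    rw [sum_mixProb_mul_eq, hjoint g t, hjoint (fun a _ => ∑ k, N.weight k * g a k) t]
    exact sum_prod_mul_eq_sum_prod_mul_mean
      (fun (t : Fin T) (h : Fin t → Fin K × Fin N.n) => π.weights t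
        (fun s => ((h s).1, N.value (N.level (σ (h s).1) (h s).2)))) (fun _ => N.weight)
      (fun t h => (π.weights_mem t _).2) (fun a => N.sum_weight) t g
  have hR : ∑ t, ∑ z, N.prob z * ∑ a, π.actionProb (N.losses σ z) a * g (a t) (z t) ≤ R := by
    rw [Finset.sum_comm]
    simp_rw [← Finset.mul_sum]
    have hz : ∀ z, N.prob z * ∑ t, ∑ a, π.actionProb (N.losses σ z) a * g (a t) (z t)
        ≤ N.prob z * R := by
      intro z
      refine mul_le_mul_of_nonneg_left (le_trans ?_ (hπ (N.losses σ z))) (N.prob_nonneg z)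
      rw [Finset.sum_comm, Strategy.integral_actionLaw]
      simp_rw [← Finset.mul_sum]
      exact Finset.sum_le_sum fun a _ => mul_le_mul_of_nonneg_left
        (sum_sub_le_regret (N.losses σ z) a b) (π.actionProb_nonneg _ _)
    refine (Finset.sum_le_sum fun z _ => hz z).trans ?_
    rw [← Finset.sum_mul, sum_prob, one_mul]
  simp_rw [hswap] at hR
  refine le_trans ?_ hR
  rw [Finset.sum_comm, Finset.sum_comm (s := Finset.univ (α := Fin T)), Finset.mul_sum]
  refine Finset.sum_le_sum fun a _ => ?_
  simp_rw [← Finset.mul_sum]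
  rw [mul_left_comm]
  refine mul_le_mul_of_nonneg_left ?_ (N.mixProb_nonneg π σ a)
  simp_rw [pulls]
  rw [Finset.sum_comm, Finset.mul_sum]
  exact Finset.sum_le_sum fun t _ => hmean (a t)

/-- Each round in which the best arm `b` is not played costs at least `Δ`, unless the noise of that
round is bad. -/
theorem mul_sub_badCount_le_regret (hΔ : 0 < Δ) (b : Fin K) (hσ : ∀ a, a ≠ b → σ a < σ b)
    (z : Fin T → Fin N.n) (a : Fin T → Fin K) :
    Δ * (T - pulls b a - N.badCount z) ≤ regret (N.losses σ z) a := by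
  refine le_trans ?_ (sum_sub_le_regret (N.losses σ z) a b)
  have hT : (T : ℝ) = ∑ _t : Fin T, 1 := by simp
  rw [hT, pulls, badCount, ← Finset.sum_sub_distrib, ← Finset.sum_sub_distrib, Finset.mul_sum]
  refine Finset.sum_le_sum fun t _ => ?_
  by_cases h : a t = b
  · rw [if_pos h, h]
    split_ifs <;> simp [hΔ.le]
  · rw [if_neg h]
    split_ifs with hk
    · have := N.value_anti (z t) (hσ _ h).le
      simp only [losses]
      linarith
    · have := N.gap_le (z t) hk _ _ (hσ _ h)
      simp only [losses]
      linarith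

/-- Of the mass δ given to `A`, bad noise takes at most δ/2. The remaining δ/2 is an average over
noise sequences, so some sequence attains it. -/
theorem exists_losses_of_le_sum_mixProb {δ θ : ℝ} (hδ : Real.exp (-(T / 32)) ≤ δ / 2)
    (A : (Fin T → Fin K) → Prop) [DecidablePred A]
    (hA : δ ≤ ∑ a, N.mixProb π σ a * (if A a then 1 else 0))
    (hreg : ∀ z a, A a → N.badCount z < 7 / 24 * T → θ ≤ regret (N.losses σ z) a) :
    ∃ ℓ : Losses K T, δ / 2 ≤ (π.actionLaw ℓ).real {a | θ ≤ regret ℓ a} := by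
  classical
  by_contra! hcon
  have hδ0 : 0 < δ := by linarith [Real.exp_pos (-((T : ℝ) / 32))]
  have hch := sum_prod_ite_le_exp N.weight N.weight_nonneg N.sum_weight N.bad N.sum_bad_le T
  rw [sum_mixProb_mul_eq] at hA
  set S : (Fin T → Fin N.n) → ℝ := fun z =>
    ∑ a, π.actionProb (N.losses σ z) a * (if A a then 1 else 0) with hS
  have hS1 : ∀ z, S z ≤ 1 := fun z => by
    rw [← π.sum_actionProb (N.losses σ z)]
    refine Finset.sum_le_sum fun a _ => ?_
    split_ifs <;> simp [π.actionProb_nonneg]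
  have hS2 : ∀ z, N.badCount z < 7 / 24 * T → S z < δ / 2 := fun z hz => by
    refine lt_of_le_of_lt ?_ (hcon (N.losses σ z))
    rw [Strategy.actionLaw_real_eq]
    refine Finset.sum_le_sum fun a _ => ?_
    by_cases ha : A a
    · simp [ha, hreg z a ha hz]
    · simp only [ha, if_false, mul_zero]
      split_ifs
      exacts [π.actionProb_nonneg _ _, le_rfl]
  have hle : ∀ z, N.prob z * S z ≤ N.prob z * (δ / 2)
      + (if 7 / 24 * (T : ℝ) ≤ N.badCount z then N.prob z else 0) := fun z => by
    have hp := N.prob_nonneg z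
    split_ifs with hz
    · nlinarith [hS1 z]
    · nlinarith [hS2 z (not_le.1 hz)]
  -- A strict inequality is needed because the final comparison of masses allows equality; any noise
  -- sequence of positive probability supplies it.
  have hlt : ∃ z, N.prob z * S z < N.prob z * (δ / 2)
      + (if 7 / 24 * (T : ℝ) ≤ N.badCount z then N.prob z else 0) := by
    obtain ⟨z, -, hz⟩ := Finset.exists_ne_zero_of_sum_ne_zero
      (s := Finset.univ) (f := fun z : Fin T → Fin N.n => N.prob z) (by rw [sum_prob]; simp)
    have hp := (N.prob_nonneg z).lt_of_ne' hz
    refine ⟨z, ?_⟩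
    split_ifs with h
    · nlinarith [hS1 z]
    · nlinarith [hS2 z (not_le.1 h)]
  obtain ⟨z, hz⟩ := hlt
  have := Finset.sum_lt_sum (fun z _ => hle z) ⟨z, Finset.mem_univ z, hz⟩
  rw [Finset.sum_add_distrib, ← Finset.sum_mul, sum_prob] at this
  have hch' : ∑ z : Fin T → Fin N.n,
      (if 7 / 24 * (T : ℝ) ≤ N.badCount z then N.prob z else 0) ≤ Real.exp (-(T / 32)) := hch
  linarith

end Noise

end Bandit

/-! ### Choice of the gap and comparison of the two environments. -/

open Bandit Bandit.Noise

theorem theorem2 {K T : ℕ} (hK : 2 ≤ K) (hT : 1 ≤ T) (π : Bandit.Strategy K T)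
    {C : ℝ} (hC : 0 < C)
    (hπ : ∀ ℓ : Bandit.Losses K T,
      ∫ a, Bandit.regret ℓ a ∂(π.actionLaw ℓ) ≤ C * Real.sqrt (((K : ℝ) - 1) * T))
    {δ : ℝ} (hδ : δ ∈ Set.Ioo (0 : ℝ) (1 / 4))
    (hδC : Real.sqrt (((K : ℝ) - 1) / T) * Real.log (1 / (4 * δ)) ≤ C)
    (hδT : 32 * Real.log (2 / δ) ≤ (T : ℝ)) :
    ∃ ℓ : Bandit.Losses K T,
      δ / 2 ≤ (π.actionLaw ℓ).real
        {a | Real.sqrt (((K : ℝ) - 1) * T) * Real.log (1 / (4 * δ)) / (203 * C)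
          ≤ Bandit.regret ℓ a} := by
  obtain ⟨hδ0, hδ4⟩ := hδ
  have hK' : (2 : ℝ) ≤ K := by exact_mod_cast hK
  have hT' : (1 : ℝ) ≤ T := by exact_mod_cast hT
  have hK1 : 0 < (K : ℝ) - 1 := by linarith
  have hT0 : (0 : ℝ) < T := by linarith
  set L := Real.log (1 / (4 * δ)) with hL
  have hL0 : 0 < L := Real.log_pos (by rw [lt_div_iff₀ (by linarith)]; linarith)
  set u := Real.sqrt (((K : ℝ) - 1) / T) with hu
  have hu0 : 0 < u := Real.sqrt_pos.2 (div_pos hK1 hT0)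
  have hu2 : u ^ 2 * T = K - 1 := by
    rw [hu, Real.sq_sqrt (div_pos hK1 hT0).le, div_mul_cancel₀ _ hT0.ne']
  have hsqrt : Real.sqrt (((K : ℝ) - 1) * T) = u * T := by
    rw [← hu2, show u ^ 2 * T * T = (u * T) ^ 2 by ring, Real.sqrt_sq (by positivity)]
  rw [hsqrt] at hπ ⊢
  -- Chosen so that the regret Δ · (5/24)T is the threshold: (24/1015)(5/24) = 1/203. The relative
  -- entropy is then at most 41.856 · (24/1015) L < L, where 41.856 = 0.545 · 64 · 6/5.
  set Δ := 24 / 1015 * (u * L / C) with hΔ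
  have hΔ0 : 0 < Δ := by positivity
  have hΔ1 : 8 * Δ ≤ 0.19 := by
    have : u * L / C ≤ 1 := (div_le_one hC).2 hδC
    rw [hΔ]; linarith
  obtain ⟨N⟩ := nonempty_noise hΔ0 hΔ1
  have hexp : Real.exp (-(T / 32)) ≤ δ / 2 := by
    have h := Real.exp_le_exp.2 (show -((T : ℝ) / 32) ≤ -Real.log (2 / δ) by linarith)
    rwa [← Real.log_inv, inv_div, Real.exp_log (by positivity)] at h
  have hthr : u * T * L / (203 * C) = Δ * (5 / 24 * T) := by
    rw [hΔ]; field_simp; norm_num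
  have hKpos : 0 < K := by omega
  let b : Fin K := ⟨0, hKpos⟩
  let σ : Fin K → Fin 3 := fun a => if a = b then 1 else 0
  have hpulls := N.sum_mixProb_mul_pulls_le π σ hΔ0 hπ b (by simp [σ])
    (fun a ha => by simp [σ, ha])
  -- Pigeonhole over the K - 1 = u²T arms other than `b`.
  obtain ⟨i, hi, hmin⟩ : ∃ i ∈ Finset.univ.erase b,
      ∑ a, N.mixProb π σ a * pulls i a ≤ C / (Δ * (5 / 6) * u) := by
    by_contra! hcon
    have hcard : ((Finset.univ.erase b).card : ℝ) = K - 1 := by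
      rw [Finset.card_erase_of_mem (Finset.mem_univ _), Finset.card_univ, Fintype.card_fin,
        Nat.cast_sub (by omega), Nat.cast_one]
    have hne : (Finset.univ.erase b).Nonempty := by
      rw [← Finset.card_pos, ← Nat.cast_pos (α := ℝ), hcard]; exact hK1
    have h := Finset.sum_lt_sum_of_nonempty hne hcon
    rw [Finset.sum_const, nsmul_eq_mul, hcard, ← hu2] at h
    have h' := mul_lt_mul_of_pos_left h (show 0 < Δ * (5 / 6) by positivity)
    have h'' : Δ * (5 / 6) * (u ^ 2 * T * (C / (Δ * (5 / 6) * u))) = C * (u * T) := by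
      field_simp
    linarith
  have hib : i ≠ b := Finset.ne_of_mem_erase hi
  let σ' : Fin K → Fin 3 := fun a => if a = i then 2 else σ a
  have hD := N.sum_obsProb_mul_logRatio_le π σ hΔ1 σ' i (fun a ha => by simp [σ', ha])
  have hDL : ∑ y, N.obsProb π σ y * N.logRatio σ σ' y ≤ L := by
    refine hD.trans ((mul_le_mul_of_nonneg_left hmin (by positivity)).trans ?_)
    have : 0.545 * (8 * Δ) ^ 2 * (C / (Δ * (5 / 6) * u)) = 41.856 * (24 / 1015) * L := by
      rw [hΔ]; field_simp; norm_num
    rw [this]; nlinarith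
  classical
  have hBH := half_exp_neg_le_sum_ite (N.obsProb π σ) (N.logRatio σ σ')
    (fun y => (T : ℝ) / 2 ≤ pulls i fun t => (y t).1) (N.obsProb_nonneg π σ) (N.sum_obsProb π σ)
    (by simp_rw [obsProb_mul_exp_neg_logRatio]; exact N.sum_obsProb π σ') hDL
  have hexpL : Real.exp (-L) / 2 = 2 * δ := by
    rw [hL, ← Real.log_inv, Real.exp_log (by positivity)]; field_simp; norm_num
  have hsplit : ∀ y, N.obsProb π σ y * (if (T : ℝ) / 2 ≤ pulls i fun t => (y t).1 then 1
      else Real.exp (-N.logRatio σ σ' y))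
      = N.obsProb π σ y * (if (T : ℝ) / 2 ≤ pulls i fun t => (y t).1 then 1 else 0)
        + N.obsProb π σ' y * (if ¬ (T : ℝ) / 2 ≤ pulls i fun t => (y t).1 then 1 else 0) := by
    intro y
    rw [← N.obsProb_mul_exp_neg_logRatio π σ σ']
    by_cases h : (T : ℝ) / 2 ≤ pulls i fun t => (y t).1 <;> simp [h]
  rw [hexpL, Finset.sum_congr rfl fun y _ => hsplit y, Finset.sum_add_distrib,
    ← N.sum_mixProb_mul π σ (fun a => if (T : ℝ) / 2 ≤ pulls i a then 1 else 0),
    ← N.sum_mixProb_mul π σ' (fun a => if ¬ (T : ℝ) / 2 ≤ pulls i a then 1 else 0)] at hBH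
  rw [hthr]
  -- Two probabilities add up to at least 2δ. Either way the best arm is missed in at least T/2
  -- rounds, fewer than 7T/24 of them bad, which leaves 5T/24.
  rcases le_or_gt δ (∑ a, N.mixProb π σ a * (if (T : ℝ) / 2 ≤ pulls i a then 1 else 0)) with h | h
  · refine N.exists_losses_of_le_sum_mixProb π σ hexp _ h fun z a ha hz => ?_
    refine le_trans ?_ (N.mul_sub_badCount_le_regret σ hΔ0 b
      (fun a ha => by simp [σ, ha]) z a)
    have hsum : pulls i a + pulls b a ≤ T := by
      have hT1 : (T : ℝ) = ∑ _t : Fin T, 1 := by simp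
      rw [pulls, pulls, ← Finset.sum_add_distrib, hT1]
      refine Finset.sum_le_sum fun t _ => ?_
      by_cases h : a t = i
      · simp [h, hib]
      · rw [if_neg h]; split_ifs <;> norm_num
    exact mul_le_mul_of_nonneg_left (by linarith) hΔ0.le
  · refine N.exists_losses_of_le_sum_mixProb π σ' hexp
      (fun a => ¬ (T : ℝ) / 2 ≤ pulls i a) (by linarith) fun z a ha hz => ?_
    refine le_trans ?_ (N.mul_sub_badCount_le_regret σ' hΔ0 i (fun a ha => ?_) z a)
    · exact mul_le_mul_of_nonneg_left (by linarith [not_le.1 ha]) hΔ0.le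
    · simp only [σ', σ, if_neg ha, if_pos]
      split_ifs <;> decide
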